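/- Let $\mathbf C$ be a small category with countably many arrows and $O$ a set. A *$\Gamma(\mathbf C)$-algebra* $\mathbb X$ is a functor $\mathbf C\to\mathbf{Set}$: a family of sets $(X_i)_{i\in|\mathbf C|}$ with functions $c_{\mathbb X}:X_i\to X_j$ for $c\in\mathbf C[i,j]$, compatible with identities and composition; homomorphisms are natural transformations. Put $\int X=\sum_i X_i$, and write $c;d$ for "first $c$, then $d$". *The functor $\mathbf{PDA}$.* The set of elements of sort $i$ of $\mathbf{PDA}(\mathbb X)$ is the set of countable sets of triples $(c,o,q)$, where $c$ is an arrow of $\mathbf C$ with source $i$, $o\in O$ and $q\in\int X$. For $d:i\to k$, $d_{\mathbf{PDA}(\mathbb X)}(A)=\{(c_2,o,q)\mid (d;c_2,o,q)\in A\}$. On homomorphisms, $\mathbf{PDA}(h)(A)=\{(c,o,h(q))\mid (c,o,q)\in A\}$. *Inference systems.* An inference system $T$ is a set of rules $c\Rightarrow^{o}_{o'}d$, where $c,d$ are arrows of $\mathbf C$ and $o,o'\in O$. Let $\Phi(T)$ be the smallest set of rules that contains $T$ and all $id_i\Rightarrow^{o}_{o}id_j$, and contains $c;d\Rightarrow^{o}_{o''}c';d'$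 whenever it contains $c\Rightarrow^{o}_{o'}c'$ and $d\Rightarrow^{o'}_{o''}d'$ and both composites are defined. For $d:i\to k$ write $(c_1,o_1,q_1)\vdash^d_{T,\mathbb X}(c_2,o_2,q_2)$ if there are arrows $e,e'$ with $c_1;e=d;c_2$, $(e\Rightarrow^{o_1}_{o_2}e')\in\Phi(T)$ and $e'_{\mathbb X}(q_1)=q_2$. A $\mathbf{PDA}$-coalgebra $\langle\mathbb X,\alpha\rangle$ *satisfies* $T$ if $(c,o,q)\in\alpha(p)$ and $(c,o,q)\vdash^d_{T,\mathbb X}(c',o',q')$ imply $(c',o',q')\in\alpha(d_{\mathbb X}(p))$. *Saturated coalgebras.* $\mathbf S_T(\mathbb X)$ consists of the countable sets of triples closed under $\vdash^{id}_{T,\mathbb X}$, with operators $d_{\mathbf S_T(\mathbb X)}(A)=\{t_2\mid \exists t_1\in A,\ t_1\vdash^d_{T,\mathbb X}t_2\}$, and it acts on homomorphisms as $\mathbf{PDA}$ does. The inclusions form a natural transformation $\iota:\mathbf S_T\Rightarrow\mathbf{PDA}$, which induces a functor $\mathbf I:\mathbf{Coalg}(\mathbf S_T)\to\mathbf{Coalg}(\mathbf{PDA})$,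 $\langle\mathbb X,\alpha\rangle\mapsto\langle\mathbb X,\alpha;\iota_{\mathbb X}\rangle$. Let $\mathbf{Coalg}(\mathbf{PDA}^I)$ be the full subcategory of $\mathbf{Coalg}(\mathbf{PDA})$ of the coalgebras whose structure map factors through $\iota_{\mathbb X}$ by a homomorphism. *Subcoalgebras and images.* $A$ is a subcoalgebra of $B$ if there is a coalgebra morphism $A\to B$ with all components injective. The homomorphic image of $A$ through a coalgebra morphism $h:A\to B$ is the coalgebra $J$ in a factorization $h=e;m$ into coalgebra morphisms $e:A\to J$, $m:J\to B$ with all components of $e$ surjective and all components of $m$ injective. Sums are small coproducts. *Saturated bisimilarity.* A context interactive system $\mathcal I$ over $\mathbf C$ and $O$ is a $\Gamma(\mathbf C)$-algebra $\mathbb X$ with a relation $tr\subseteq\int X\times O\times\int X$; it has countable degree if each $p\in\int X$ has countably many transitions $(p,o,q)\in tr$. A saturated bisimulation is a family of symmetric relations $R_i\subseteq X_i\times X_i$ such that $p\,R_i\,q$ implies $c_{\mathbb X}(p)\,R_j\,c_{\mathbb X}(q)$ for every $c:i\to j$ and, whenever $(p,o,p')\in tr$ with $p'\in X_k$, there is $q'\in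 X_k$ with $(q,o,q')\in tr$ and $p'\,R_k\,q'$. Write $p\sim^S_i q$ if $p\,R_i\,q$ for some saturated bisimulation $R$. If $\mathcal I$ has countable degree, $\langle\mathbb X,\alpha_{\mathcal I}\rangle$ is the $\mathbf{PDA}$-coalgebra with $\alpha_{\mathcal I}(p)=\{(c,o,q)\mid(c_{\mathbb X}(p),o,q)\in tr\}$. **Theorem.** Let $T$ be an inference system. 1. A $\mathbf{PDA}$-coalgebra is in $\mathbf{Coalg}(\mathbf{PDA}^I)$ if and only if it satisfies $T$. Homomorphic images and sums exist in $\mathbf{Coalg}(\mathbf{PDA})$, and the $\mathbf{PDA}$-coalgebras that satisfy $T$ form a covariety: they are closed under subcoalgebras, homomorphic images and sums. 2. $\mathbf I$ is an isomorphism of categories $\mathbf{Coalg}(\mathbf S_T)\cong\mathbf{Coalg}(\mathbf{PDA}^I)$, and the categories $\mathbf{Coalg}(\mathbf{PDA})$, $\mathbf{Coalg}(\mathbf{PDA}^I)$ and $\mathbf{Coalg}(\mathbf S_T)$ have final objects. 3. For every coalgebra in $\mathbf{Coalg}(\mathbf{PDA}^I)$, the final morphism in $\mathbf{Coalg}(\mathbf{PDA}^I)$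 has the same kernel as the final morphism in $\mathbf{Coalg}(\mathbf{PDA})$. For every $\mathbf S_T$-coalgebra $A$, the final morphism of $A$ in $\mathbf{Coalg}(\mathbf S_T)$ has the same kernel as the final morphism of $\mathbf I(A)$ in $\mathbf{Coalg}(\mathbf{PDA})$. 4. Let $\mathcal I$ be a context interactive system of countable degree over $\mathbf C$ and $O$, with algebra $\mathbb X$. The kernel of the final $\mathbf{PDA}$-morphism from $\langle\mathbb X,\alpha_{\mathcal I}\rangle$ is $\sim^S$. If $\langle\mathbb X,\alpha_{\mathcal I}\rangle$ satisfies $T$, then $\alpha_{\mathcal I}=\alpha'_{\mathcal I};\iota_{\mathbb X}$ for a unique homomorphism $\alpha'_{\mathcal I}:\mathbb X\to\mathbf S_T(\mathbb X)$, and the kernel of the final $\mathbf S_T$-morphism from $\langle\mathbb X,\alpha'_{\mathcal I}\rangle$ is $\sim^S$. -/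

import Mathlib

open CategoryTheory Limits

universe u

namespace SatCoalg

variable {C : Type u} [SmallCategory C] {O : Type u}

/-- The set `∫ X` of elements of a sorted family `X`. -/
abbrev Elements (X : C → Type u) : Type u := Σ k : C, X k

/-- A triple `(c, o, q)` with `c` an arrow of source `i`, `o` an observation and `q ∈ ∫ X`. -/
@[ext]
structure Transition (O : Type u) (X : C → Type u) (i : C) : Type u where
  cod : C
  ctx : i ⟶ cod
  obs : O
  tgt : Elements X

/-- The action of a sorted family of functions on triples. -/
def Transition.map {X Y : C → Type u} (f : ∀ k, X k → Y k) {i : C} (t : Transition O X i) :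
    Transition O Y i :=
  ⟨t.cod, t.ctx, t.obs, ⟨t.tgt.1, f t.tgt.1 t.tgt.2⟩⟩

/-- Precomposition of the context of a triple with an arrow `d`. -/
def Transition.pre {X : C → Type u} {i k : C} (d : i ⟶ k) (t : Transition O X k) : Transition O X i :=
  ⟨t.cod, d ≫ t.ctx, t.obs, t.tgt⟩

/-- The carrier of sort `i`: the countable sets of triples `(c, o, q)` with `c` of source `i`. -/
def PD (O : Type u) (X : C → Type u) (i : C) : Type u :=
  {A : Set (Transition O X i) // A.Countable}

theorem Transition.id_pre {X : C → Type u} {i : C} (t : Transition O X i) : t.pre (𝟙 i) = t := by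
  simp [Transition.pre]

theorem Transition.comp_pre {X : C → Type u} {i j k : C} (d : i ⟶ j) (e : j ⟶ k) (t : Transition O X k) :
    t.pre (d ≫ e) = (t.pre e).pre d := by
  simp [Transition.pre]

/-- Only countably many triples become a given triple by precomposition with `d`. -/
theorem countable_preimage_pre [CountableCategory C] {X : C → Type u} {i k : C} (d : i ⟶ k)
    {A : Set (Transition O X i)} (hA : A.Countable) : {t : Transition O X k | t.pre d ∈ A}.Countable := by
  have h : ({t : Transition O X k | t.pre d ∈ A}) ⊆ ⋃ (j : C) (c : k ⟶ j),
      (fun s : Transition O X i => (⟨j, c, s.obs, s.tgt⟩ : Transition O X k)) '' A := by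
    intro t ht
    simp only [Set.mem_iUnion]
    exact ⟨t.cod, t.ctx, t.pre d, ht, rfl⟩
  exact (Set.countable_iUnion fun j => Set.countable_iUnion fun c => hA.image _).mono h

/-- The `Γ(C)`-algebra `PDA(X)`. The operator `d` sends `A` to
`{(c₂, o, x) | (c₁, o, x) ∈ A and c₁ = d ; c₂}`. -/
def pdaAlg (O : Type u) [CountableCategory C] (X : C ⥤ Type u) : C ⥤ Type u where
  obj i := PD O X.obj i
  map d := ↾(fun A => ⟨{t | t.pre d ∈ A.1}, countable_preimage_pre d A.2⟩)
  map_id i := by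
    ext A
    apply Subtype.ext
    ext t
    change t.pre (𝟙 i) ∈ A.1 ↔ t ∈ A.1
    rw [Transition.id_pre]
  map_comp d e := by
    ext A
    apply Subtype.ext
    ext t
    change t.pre (d ≫ e) ∈ A.1 ↔ (t.pre e).pre d ∈ A.1
    rw [Transition.comp_pre]

/-- The image of a countable set of triples under a sorted family of functions. -/
def PD.map {X Y : C → Type u} (f : ∀ k, X k → Y k) {i : C} (A : PD O X i) : PD O Y i :=
  ⟨Transition.map f '' A.1, A.2.image _⟩

/-- The endofunctor `PDA` on `Γ(C)`-algebras, that is, on functors from `C` to sets. -/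
def PDA (C : Type u) [SmallCategory C] [CountableCategory C] (O : Type u) :
    (C ⥤ Type u) ⥤ (C ⥤ Type u) where
  obj X := pdaAlg O X
  map {X Y} h :=
    { app := fun i => ↾(fun A : PD O X.obj i => (PD.map (fun k => h.app k) A : PD O Y.obj i))
      naturality := by
        intro i k d
        ext A
        apply Subtype.ext
        ext t
        constructor
        · rintro ⟨s, hs, rfl⟩
          exact ⟨s.pre d, hs, rfl⟩
        · rintro ⟨s, hs, hst⟩
          obtain ⟨j, c, o, q⟩ := s
          obtain ⟨j', c', o', q'⟩ := t
          simp only [Transition.map, Transition.pre, Transition.mk.injEq] at hst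
          obtain ⟨rfl, hc, rfl, rfl⟩ := hst
          obtain rfl := eq_of_heq hc
          exact ⟨⟨j, c', o, q⟩, hs, rfl⟩ }
  map_id X := by
    ext i A
    apply Subtype.ext
    exact Set.image_id A.1
  map_comp f g := by
    ext i A
    apply Subtype.ext
    exact Set.image_comp (Transition.map fun k => g.app k) (Transition.map fun k => f.app k) A.1

/-- A rule with premise `p_i --o--> q_j` and conclusion `c(p_i) --o'--> d(q_j)`. -/
structure Rule (C : Type u) [SmallCategory C] (O : Type u) : Type u where
  {i i' j j' : C}
  c : i ⟶ i'
  o : O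
  o' : O
  d : j ⟶ j'

/-- The closure `Φ(T)`: the rules derivable from `T` and the identity rules by composition. -/
inductive Closure (T : Set (Rule C O)) :
    ∀ {i i' j j' : C}, (i ⟶ i') → O → O → (j ⟶ j') → Prop
  | base {i i' j j' : C} (c : i ⟶ i') (o o' : O) (d : j ⟶ j') :
      (⟨c, o, o', d⟩ : Rule C O) ∈ T → Closure T c o o' d
  | id (i j : C) (o : O) : Closure T (𝟙 i) o o (𝟙 j)
  | comp {i i' i'' j j' j'' : C} {c : i ⟶ i'} {d : i' ⟶ i''} {c' : j ⟶ j'} {d' : j' ⟶ j''}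
      {o o' o'' : O} : Closure T c o o' c' → Closure T d o' o'' d' →
      Closure T (c ≫ d) o o'' (c' ≫ d')

/-- Extended derivation `t₁ ⊢^d t₂` in the algebra `X` through `T`. -/
def Deriv (T : Set (Rule C O)) (X : C ⥤ Type u) {i k : C} (d : i ⟶ k)
    (t₁ : Transition O X.obj i) (t₂ : Transition O X.obj k) : Prop :=
  ∃ (e : t₁.cod ⟶ t₂.cod) (e' : t₁.tgt.1 ⟶ t₂.tgt.1),
    t₁.ctx ≫ e = d ≫ t₂.ctx ∧ Closure T e t₁.obs t₂.obs e' ∧ X.map e' t₁.tgt.2 = t₂.tgt.2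

/-- A set of triples is saturated if it is closed under derivation through the identity. -/
def IsSaturated (T : Set (Rule C O)) (X : C ⥤ Type u) {i : C} (A : Set (Transition O X.obj i)) : Prop :=
  ∀ t₁ ∈ A, ∀ t₂, Deriv T X (𝟙 i) t₁ t₂ → t₂ ∈ A

/-- The countable saturated sets of triples. -/
def PS (T : Set (Rule C O)) (X : C ⥤ Type u) (i : C) : Type u :=
  {A : PD O X.obj i // IsSaturated T X A.1}

theorem Deriv.refl_pre (T : Set (Rule C O)) (X : C ⥤ Type u) {i k : C} (d : i ⟶ k)
    (t : Transition O X.obj k) : Deriv T X d (t.pre d) t :=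
  ⟨𝟙 t.cod, 𝟙 t.tgt.1, by simp [Transition.pre], Closure.id _ _ _,
    Functor.map_id_apply X _ t.tgt.2⟩

theorem Deriv.trans {T : Set (Rule C O)} {X : C ⥤ Type u} {i j k : C} {d : i ⟶ j} {e : j ⟶ k}
    {t₁ : Transition O X.obj i} {t₂ : Transition O X.obj j} {t₃ : Transition O X.obj k}
    (h₁ : Deriv T X d t₁ t₂) (h₂ : Deriv T X e t₂ t₃) : Deriv T X (d ≫ e) t₁ t₃ := by
  obtain ⟨a, a', ha, hT, hx⟩ := h₁
  obtain ⟨b, b', hb, hT', hx'⟩ := h₂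
  refine ⟨a ≫ b, a' ≫ b', ?_, hT.comp hT', ?_⟩
  · rw [← Category.assoc, ha, Category.assoc, hb, Category.assoc]
  · simp [hx, hx']

theorem deriv_pre_iff {T : Set (Rule C O)} {X : C ⥤ Type u} {i k : C} {d : i ⟶ k}
    {t₁ : Transition O X.obj i} {t₂ : Transition O X.obj k} :
    Deriv T X (𝟙 i) t₁ (t₂.pre d) ↔ Deriv T X d t₁ t₂ := by
  have h : 𝟙 i ≫ (t₂.pre d).ctx = d ≫ t₂.ctx := Category.id_comp _
  unfold Deriv
  rw [h]
  exact Iff.rfl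

/-- The set of triples derived through `d` from the triples in `A`. -/
def derivedSet (T : Set (Rule C O)) (X : C ⥤ Type u) {i k : C} (d : i ⟶ k)
    (A : Set (Transition O X.obj i)) : Set (Transition O X.obj k) :=
  {t₂ | ∃ t₁ ∈ A, Deriv T X d t₁ t₂}

theorem derivedSet_eq {T : Set (Rule C O)} {X : C ⥤ Type u} {i k : C} (d : i ⟶ k)
    {A : Set (Transition O X.obj i)} (hA : IsSaturated T X A) :
    derivedSet T X d A = {t | t.pre d ∈ A} := by
  ext t
  constructor
  · rintro ⟨s, hs, h⟩
    exact hA s hs _ (deriv_pre_iff.2 h)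
  · intro h
    exact ⟨t.pre d, h, Deriv.refl_pre T X d t⟩

theorem isSaturated_derivedSet {T : Set (Rule C O)} {X : C ⥤ Type u} {i k : C} (d : i ⟶ k)
    (A : Set (Transition O X.obj i)) : IsSaturated T X (derivedSet T X d A) := by
  rintro t₁ ⟨s, hs, h⟩ t₂ h'
  exact ⟨s, hs, by simpa using h.trans h'⟩

theorem IsSaturated.image {T : Set (Rule C O)} {X Y : C ⥤ Type u} (h : X ⟶ Y) {i : C}
    {A : Set (Transition O X.obj i)} (hA : IsSaturated T X A) :
    IsSaturated T Y (Transition.map (fun k => h.app k) '' A) := by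
  rintro _ ⟨⟨j, c, o, ⟨l, x⟩⟩, hs, rfl⟩ ⟨j', c', o', ⟨l', y⟩⟩ ⟨e, e', he, hT, hx⟩
  refine ⟨⟨j', c', o', ⟨l', X.map e' x⟩⟩, hA _ hs _ ⟨e, e', he, hT, rfl⟩, ?_⟩
  have hy : h.app l' (X.map e' x) = y := by
    exact (NatTrans.naturality_apply h e' x).trans hx
  change Transition.mk j' c' o' ⟨l', h.app l' (X.map e' x)⟩ = _
  rw [hy]

/-- The `Γ(C)`-algebra `S_T(X)` of saturated sets. The operator `d` sends `A` to the set of all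
triples derived from `A` through `d`. -/
def satAlg [CountableCategory C] (T : Set (Rule C O)) (X : C ⥤ Type u) : C ⥤ Type u where
  obj i := PS T X i
  map d := ↾(fun A => ⟨⟨derivedSet T X d A.1.1, by
    rw [derivedSet_eq d A.2]; exact countable_preimage_pre d A.1.2⟩, isSaturated_derivedSet d _⟩)
  map_id i := by
    ext A
    apply Subtype.ext
    apply Subtype.ext
    change derivedSet T X (𝟙 i) A.1.1 = A.1.1
    rw [derivedSet_eq _ A.2]
    simp [Transition.id_pre]
  map_comp {i j k} d e := by
    ext A
    apply Subtype.ext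
    apply Subtype.ext
    change derivedSet T X (d ≫ e) A.1.1 = derivedSet T X e (derivedSet T X d A.1.1)
    rw [derivedSet_eq _ (isSaturated_derivedSet d _), derivedSet_eq _ A.2, derivedSet_eq _ A.2]
    simp [Transition.comp_pre]

/-- The endofunctor `S_T`; on arrows it is defined as `PDA`. -/
def ST [CountableCategory C] (T : Set (Rule C O)) : (C ⥤ Type u) ⥤ (C ⥤ Type u) where
  obj X := satAlg T X
  map {X Y} h :=
    { app := fun i => ↾(fun A : PS T X i =>
        (⟨PD.map (fun k => h.app k) A.1, A.2.image h⟩ : PS T Y i))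
      naturality := by
        intro i k d
        ext A
        apply Subtype.ext
        have := congrArg (fun f => f A.1) (((PDA C O).map h).naturality d)
        apply Subtype.ext
        change Transition.map _ '' derivedSet T X d A.1.1 = derivedSet T Y d (Transition.map _ '' A.1.1)
        rw [derivedSet_eq _ A.2, derivedSet_eq _ (A.2.image h)]
        exact congrArg Subtype.val this }
  map_id X := by
    ext i A
    apply Subtype.ext
    apply Subtype.ext
    exact Set.image_id A.1.1
  map_comp f g := by
    ext i A
    apply Subtype.ext
    apply Subtype.ext
    exact Set.image_comp (Transition.map fun k => g.app k) (Transition.map fun k => f.app k) A.1.1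

/-- The natural transformation `ι : S_T ⟶ PDA` whose components are the inclusions. -/
def incl [CountableCategory C] (T : Set (Rule C O)) : ST T ⟶ PDA C O where
  app X :=
    { app := fun i => ↾(fun A : PS T X i => (A.1 : PD O X.obj i))
      naturality := by
        intro i k d
        ext A
        apply Subtype.ext
        exact derivedSet_eq d A.2 }
  naturality _ _ _ := rfl

/-- The category of coalgebras of `PDA`. -/
abbrev CoalgPDA (C : Type u) [SmallCategory C] [CountableCategory C] (O : Type u) :=
  Endofunctor.Coalgebra (PDA C O)

/-- The category of coalgebras of `S_T`. -/
abbrev CoalgST [CountableCategory C] (T : Set (Rule C O)) :=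
  Endofunctor.Coalgebra (ST T)

/-- The set `α(p)` of outgoing transitions of a state `p` of a `PDA`-coalgebra. -/
def outgoing [CountableCategory C] (A : CoalgPDA C O) {i : C} (p : A.V.obj i) :
    Set (Transition O A.V.obj i) :=
  (show PD O A.V.obj i from A.str.app i p).1

/-- A `PDA`-coalgebra satisfies `T`. -/
def Satisfies [CountableCategory C] (T : Set (Rule C O)) : ObjectProperty (CoalgPDA C O) :=
  fun A => ∀ ⦃i k : C⦄ (d : i ⟶ k) (p : A.V.obj i) (t : Transition O A.V.obj i)
    (t' : Transition O A.V.obj k), t ∈ outgoing A p → Deriv T A.V d t t' → t' ∈ outgoing A (A.V.map d p)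

/-- A `PDA`-coalgebra factors through `ι`. -/
def Factors [CountableCategory C] (T : Set (Rule C O)) : ObjectProperty (CoalgPDA C O) :=
  fun A => ∃ α' : A.V ⟶ (ST T).obj A.V, α' ≫ (incl T).app A.V = A.str

/-- The category `Coalg(PDA^I)`: the full subcategory of the coalgebras that factor through `ι`. -/
abbrev CoalgPDAI [CountableCategory C] (T : Set (Rule C O)) := (Factors T).FullSubcategory

/-- The functor `I : Coalg(S_T) ⥤ Coalg(PDA)` induced by `ι`. -/
abbrev inclCoalg [CountableCategory C] (T : Set (Rule C O)) : CoalgST T ⥤ CoalgPDA C O :=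
  Endofunctor.Coalgebra.functorOfNatTrans (incl T)

/-- The functor `I` with its codomain restricted to `Coalg(PDA^I)`. -/
abbrev toCoalgPDAI [CountableCategory C] (T : Set (Rule C O)) : CoalgST T ⥤ CoalgPDAI T :=
  (Factors T).lift (inclCoalg T) fun A => ⟨A.str, rfl⟩

/-- All components of a homomorphism of algebras are epi. -/
def EpiComponents {X Y : C ⥤ Type u} (h : X ⟶ Y) : Prop := ∀ i : C, Epi (h.app i)

/-- All components of a homomorphism of algebras are mono. -/
def MonoComponents {X Y : C ⥤ Type u} (h : X ⟶ Y) : Prop := ∀ i : C, Mono (h.app i)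

/-- `A` is a subcoalgebra of `B`. -/
def IsSubcoalgebra [CountableCategory C] (A B : CoalgPDA C O) : Prop :=
  ∃ m : A ⟶ B, MonoComponents m.f

/-- `J` is a homomorphic image of `A` through `h`. -/
def IsHomomorphicImage [CountableCategory C] {A B : CoalgPDA C O} (h : A ⟶ B)
    (J : CoalgPDA C O) : Prop :=
  ∃ (e : A ⟶ J) (m : J ⟶ B), EpiComponents e.f ∧ MonoComponents m.f ∧ e ≫ m = h

/-- A class of `PDA`-coalgebras is a covariety: it is closed under subcoalgebras, homomorphic
images and (small) sums. -/
structure IsCovariety [CountableCategory C] (P : ObjectProperty (CoalgPDA C O)) : Prop where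
  sub : ∀ A B : CoalgPDA C O, IsSubcoalgebra A B → P B → P A
  image : ∀ (A B : CoalgPDA C O) (h : A ⟶ B) (J : CoalgPDA C O),
    IsHomomorphicImage h J → P A → P J
  sum : ∀ (K : Type u) (A : K → CoalgPDA C O) (c : Cofan A), IsColimit c →
    (∀ k, P (A k)) → P c.pt

/-- A context interactive system over the category `C` with observations in `O`. -/
structure CIS (C : Type u) [SmallCategory C] (O : Type u) where
  alg : C ⥤ Type u
  tr : Set (Elements alg.obj × O × Elements alg.obj)

/-- Every state has countably many outgoing transitions. -/
def CIS.CountableDegree (I : CIS C O) : Prop :=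
  ∀ p : Elements I.alg.obj, {t : O × Elements I.alg.obj | (p, t.1, t.2) ∈ I.tr}.Countable

/-- Saturated bisimulations. -/
def CIS.IsSatBisimulation (I : CIS C O) (R : ∀ i : C, I.alg.obj i → I.alg.obj i → Prop) : Prop :=
  (∀ i p q, R i p q → R i q p) ∧
  (∀ (i j : C) (c : i ⟶ j) (p q), R i p q → R j (I.alg.map c p) (I.alg.map c q)) ∧
  (∀ i p q, R i p q → ∀ (o : O) (k : C) (p' : I.alg.obj k), (⟨i, p⟩, o, ⟨k, p'⟩) ∈ I.tr →
    ∃ q' : I.alg.obj k, (⟨i, q⟩, o, ⟨k, q'⟩) ∈ I.tr ∧ R k p' q')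

/-- Saturated bisimilarity `∼^S`. -/
def CIS.SatBisim (I : CIS C O) {i : C} (p q : I.alg.obj i) : Prop :=
  ∃ R : ∀ i : C, I.alg.obj i → I.alg.obj i → Prop, I.IsSatBisimulation R ∧ R i p q

/-- The saturated transitions of a state `p`: `(c, o, q)` with `c(p) --o--> q`. -/
def CIS.satTrans (I : CIS C O) {i : C} (p : I.alg.obj i) : Set (Transition O I.alg.obj i) :=
  {t | ((⟨t.cod, I.alg.map t.ctx p⟩ : Elements I.alg.obj), t.obs, t.tgt) ∈ I.tr}

theorem CIS.countable_satTrans [CountableCategory C] (I : CIS C O) (hI : I.CountableDegree)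
    {i : C} (p : I.alg.obj i) : (I.satTrans p).Countable := by
  have h : I.satTrans p ⊆ ⋃ (j : C) (c : i ⟶ j),
      (fun s : O × Elements I.alg.obj => (⟨j, c, s.1, s.2⟩ : Transition O I.alg.obj i)) ''
        {s | ((⟨j, I.alg.map c p⟩ : Elements I.alg.obj), s.1, s.2) ∈ I.tr} := by
    intro t ht
    simp only [Set.mem_iUnion]
    exact ⟨t.cod, t.ctx, (t.obs, t.tgt), ht, rfl⟩
  exact (Set.countable_iUnion fun j => Set.countable_iUnion fun c => (hI _).image _).mono h

/-- The `PDA`-coalgebra of the saturated transition system of `I`. -/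
def CIS.satCoalg [CountableCategory C] (I : CIS C O) (hI : I.CountableDegree) :
    CoalgPDA C O where
  V := I.alg
  str :=
    { app := fun i => ↾(fun p => (⟨I.satTrans p, I.countable_satTrans hI p⟩ : PD O I.alg.obj i))
      naturality := by
        intro i k d
        ext p
        apply Subtype.ext
        ext t
        change ((⟨t.cod, I.alg.map t.ctx (I.alg.map d p)⟩ : Elements I.alg.obj), t.obs, t.tgt) ∈ I.tr
          ↔ ((⟨t.cod, I.alg.map (d ≫ t.ctx) p⟩ : Elements I.alg.obj), t.obs, t.tgt) ∈ I.tr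
        simp }

end SatCoalg

/-!
`PDA` preserves injections, so a morphism of coalgebras factors through its set-theoretic image, and
the forgetful functor creates colimits, so sums are computed on carriers. Each state has countably
many transitions and `C` has countably many arrows, so each state lies in a countable subcoalgebra.
Hence the coalgebras on sets of natural numbers form a small separating family; as coalgebras are
cocomplete and each has only a set of quotients, the special adjoint functor theorem gives a final
coalgebra.

A covariety has a final object as well: the union of the images of its members in the final
coalgebra `F`. It is a subcoalgebra of `F`, so restricting to the covariety does not change the
kernels of final morphisms. A coalgebra factors through `ι` exactly when its sets of outgoing
transitions are saturated; as `t ⊢^d t'` holds iff `t ⊢^id t'.pre d`, this is satisfaction of `T`,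
which defines a covariety because derivations are preserved by homomorphisms and lift along them.

The kernel of a final morphism is a bisimulation. Conversely, a bisimulation is itself the carrier
of a coalgebra whose two projections are morphisms, and the final morphisms agree on it.
-/

namespace SatCoalg

section StrictInverse

variable {D : Type*} [Category* D] {E : Type*} [Category* E]

theorem exists_strict_inverse (G : D ⥤ E) [G.Full] [G.Faithful] (hG : Function.Bijective G.obj) :
    ∃ H : E ⥤ D, G ⋙ H = 𝟭 D ∧ H ⋙ G = 𝟭 E := by
  obtain ⟨inv, left_inv, right_inv⟩ := Function.bijective_iff_has_inverse.1 hG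
  let H : E ⥤ D :=
    { obj := inv
      map {X Y} f := G.preimage (eqToHom (right_inv X) ≫ f ≫ eqToHom (right_inv Y).symm)
      map_id X := G.map_injective (by simp)
      map_comp f g := G.map_injective (by simp) }
  refine ⟨H, CategoryTheory.Functor.ext left_inv fun X Y f => G.map_injective ?_,
    CategoryTheory.Functor.ext right_inv fun X Y f => ?_⟩
  · simp [H, eqToHom_map]
  · simp [H]

end StrictInverse

section Coalgebra

open Endofunctor.Coalgebra

variable {D : Type*} [Category* D] {F : D ⥤ D}

section Lift

variable {A B J : Endofunctor.Coalgebra F}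

theorem map_comp_str_of_mono (m : J ⟶ B) [Mono (F.map m.f)] (f : A ⟶ B) {g : A.V ⟶ J.V}
    (w : g ≫ m.f = f.f) : A.str ≫ F.map g = g ≫ J.str := by
  rw [← cancel_mono (F.map m.f), Category.assoc, ← F.map_comp, w, f.h, Category.assoc, m.h,
    reassoc_of% w]

theorem map_comp_str_of_epi (e : A ⟶ J) [Epi e.f] (f : A ⟶ B) {g : J.V ⟶ B.V}
    (w : e.f ≫ g = f.f) : J.str ≫ F.map g = g ≫ B.str := by
  rw [← cancel_epi e.f, ← e.h_assoc, ← F.map_comp, w, f.h, reassoc_of% w]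

end Lift

section Colimit

variable {K : Type*} [Category* K] (S : K ⥤ Endofunctor.Coalgebra F)

/-- The structure maps of a diagram of coalgebras, composed with the image under `F` of a cocone
over the carriers. -/
def strCocone (c : Cocone (S ⋙ forget F)) : Cocone (S ⋙ forget F) where
  pt := F.obj c.pt
  ι :=
    { app k := (S.obj k).str ≫ F.map (c.ι.app k)
      naturality k l a := by
        have hc : (S.map a).f ≫ c.ι.app l = c.ι.app k := c.w a
        change (S.map a).f ≫ (S.obj l).str ≫ F.map (c.ι.app l) = (_ ≫ F.map (c.ι.app k)) ≫ 𝟙 _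
        rw [Category.comp_id, ← hc, ← (S.map a).h_assoc]
        exact congrArg ((S.obj k).str ≫ ·) (F.map_comp _ _).symm }

variable {c : Cocone (S ⋙ forget F)} (hc : IsColimit c)

/-- A colimit cocone over the carriers of a diagram of coalgebras, as a cocone of coalgebras. -/
def colimitCocone : Cocone S where
  pt := { V := c.pt, str := hc.desc (strCocone S c) }
  ι :=
    { app k := { f := c.ι.app k, h := (hc.fac (strCocone S c) k).symm }
      naturality k l a := by
        ext1
        exact c.ι.naturality a }

def isColimitColimitCocone : IsColimit (colimitCocone S hc) where
  desc s :=
    { f := hc.desc ((forget F).mapCocone s)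
      h := hc.hom_ext fun k => by
        let leg : (S.obj k).V ⟶ c.pt := c.ι.app k
        let str : c.pt ⟶ F.obj c.pt := hc.desc (strCocone S c)
        let g : c.pt ⟶ s.pt.V := hc.desc ((forget F).mapCocone s)
        have hstr : leg ≫ str = (S.obj k).str ≫ F.map leg := hc.fac (strCocone S c) k
        have hg : leg ≫ g = (s.ι.app k).f := hc.fac ((forget F).mapCocone s) k
        calc leg ≫ str ≫ F.map g
          _ = (S.obj k).str ≫ F.map (leg ≫ g) := by rw [reassoc_of% hstr, F.map_comp]
          _ = (s.ι.app k).f ≫ s.pt.str := hg ▸ (s.ι.app k).h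
          _ = leg ≫ g ≫ s.pt.str := by rw [reassoc_of% hg] }
  fac s k := by
    ext1
    exact hc.fac ((forget F).mapCocone s) k
  uniq s m w := by
    ext1
    exact hc.uniq ((forget F).mapCocone s) m.f fun k => congrArg Hom.f (w k)

noncomputable instance : CreatesColimit S (forget F) :=
  createsColimitOfReflectsIso fun c hc =>
    { liftedCocone := colimitCocone S hc
      validLift := Cocone.ext (Iso.refl c.pt) fun _ => Category.comp_id _
      makesColimit := isColimitColimitCocone S hc }

end Colimit

section NatTrans

variable {G : D ⥤ D} (α : F ⟶ G)

instance : (functorOfNatTrans α).Faithful where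
  map_injective h := Hom.ext (congrArg (Hom.f (F := G)) h)

variable [∀ X, Mono (α.app X)]

instance : (functorOfNatTrans α).Full where
  map_surjective {A B} g := by
    let f : A.V ⟶ B.V := g.f
    refine ⟨{ f := f, h := ?_ }, rfl⟩
    have hf : (A.str ≫ α.app A.V) ≫ G.map f = f ≫ B.str ≫ α.app B.V := g.h
    rw [← cancel_mono (α.app B.V), Category.assoc, α.naturality, ← Category.assoc, hf,
      Category.assoc]

theorem functorOfNatTrans_obj_injective : Function.Injective (functorOfNatTrans α).obj := by
  rintro ⟨V, s⟩ ⟨W, t⟩ h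
  injection h with hV hs
  subst hV
  congr
  exact (cancel_mono _).1 (eq_of_heq hs)

end NatTrans

section Terminal

universe w

variable {D : Type*} [Category.{w} D] {F : D ⥤ D}

noncomputable instance {J : Type*} [Category* J] : CreatesColimitsOfShape J (forget F) := {}

instance [HasPushouts D] : (forget F).PreservesEpimorphisms :=
  have := preservesColimitOfShape_of_createsColimitsOfShape_and_hasColimitsOfShape
    (J := WalkingSpan) (forget F)
  inferInstance

open Opposite in
instance wellPowered_coalgebra_op [HasPushouts D] [WellPowered.{w} Dᵒᵖ] :
    WellPowered.{w} (Endofunctor.Coalgebra F)ᵒᵖ where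
  subobject_small A := by
    have epi_f (P : Subobject A) : Epi P.arrow.unop.f := (forget F).map_epi P.arrow.unop
    let carrier (P : Subobject A) : Subobject (op A.unop.V) := Subobject.mk P.arrow.unop.f.op
    have le_of_carrier_le (P Q : Subobject A) (h : carrier P ≤ carrier Q) : P ≤ Q := by
      let g := Subobject.ofMkLEMk P.arrow.unop.f.op Q.arrow.unop.f.op h
      have hg : Q.arrow.unop.f ≫ g.unop = P.arrow.unop.f :=
        congrArg Quiver.Hom.unop (Subobject.ofMkLEMk_comp h)
      let g' : unop (Q : (Endofunctor.Coalgebra F)ᵒᵖ) ⟶ unop (P : (Endofunctor.Coalgebra F)ᵒᵖ) :=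
        { f := g.unop, h := map_comp_str_of_epi _ _ hg }
      exact Subobject.le_of_comm g'.op (Quiver.Hom.unop_inj (Hom.ext hg))
    exact small_of_injective (f := carrier) fun P Q h =>
      le_antisymm (le_of_carrier_le P Q h.le) (le_of_carrier_le Q P h.ge)

theorem hasTerminal_coalgebra [HasColimitsOfSize.{w, w} D] [WellPowered.{w} Dᵒᵖ]
    {P : ObjectProperty (Endofunctor.Coalgebra F)} [ObjectProperty.Small.{w} P]
    (hP : P.IsSeparating) : HasTerminal (Endofunctor.Coalgebra F) :=
  have : HasColimitsOfSize.{w, w} (Endofunctor.Coalgebra F) :=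
    ⟨fun _ _ => hasColimitsOfShape_of_hasColimitsOfShape_createsColimitsOfShape (forget F)⟩
  hasTerminal_of_isSeparating.{w} hP

end Terminal

end Coalgebra

section FunctorToTypes

universe w

theorem exists_comp_eq_of_epi {C : Type*} [Category* C] {X Y Z : C ⥤ Type w} (e : X ⟶ Y) [Epi e]
    (f : X ⟶ Z) (h : ∀ i x y, e.app i x = e.app i y → f.app i x = f.app i y) :
    ∃ g, e ≫ g = f := by
  have := IsRegularEpiCategory.regularEpiOfEpi e
  have hf : IsRegularEpi.left e ≫ f = IsRegularEpi.right e ≫ f := by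
    ext i x
    exact h i _ _ (congrArg (fun k => k.app i x) (IsRegularEpi.w e))
  exact ⟨IsRegularEpi.desc e f hf, IsRegularEpi.fac e f hf⟩

theorem exists_comp_eq_iff_range_le {C : Type*} [Category* C] {X Y Z : C ⥤ Type w} (m : Y ⟶ Z)
    [Mono m] (f : X ⟶ Z) : (∃ g, g ≫ m = f) ↔ Subfunctor.range f ≤ Subfunctor.range m := by
  constructor
  · rintro ⟨g, rfl⟩
    exact Subfunctor.range_comp_le g m
  · intro h
    refine ⟨Subfunctor.lift f h ≫ inv (Subfunctor.toRange m), ?_⟩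
    calc (Subfunctor.lift f h ≫ inv (Subfunctor.toRange m)) ≫ m
      _ = Subfunctor.lift f h ≫ (Subfunctor.range m).ι := by
        rw [Category.assoc, (IsIso.inv_comp_eq _).2 (Subfunctor.toRange_ι m).symm]
      _ = f := Subfunctor.lift_ι f h

open Opposite in
instance wellPowered_functorToTypes_op {C : Type w} [SmallCategory C] :
    WellPowered.{w} (C ⥤ Type w)ᵒᵖ where
  subobject_small X := by
    let kernel (P : Subobject X) (i : C) : Setoid (X.unop.obj i) :=
      Setoid.ker (P.arrow.unop.app i)
    have le_of_kernel_le (P Q : Subobject X) (h : kernel Q ≤ kernel P) : P ≤ Q := by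
      obtain ⟨g, hg⟩ := exists_comp_eq_of_epi Q.arrow.unop P.arrow.unop fun i _ _ hxy => h i hxy
      exact Subobject.le_of_comm g.op (Quiver.Hom.unop_inj hg)
    exact small_of_injective (f := kernel) fun P Q h =>
      le_antisymm (le_of_kernel_le P Q h.ge) (le_of_kernel_le Q P h.le)

end FunctorToTypes

theorem countable_setOf_reflTransGen {α : Type*} {r : α → α → Prop}
    (hr : ∀ a, {b | r a b}.Countable) (a : α) : {b | Relation.ReflTransGen r a b}.Countable := by
  let S : ℕ → Set α := Nat.rec {a} fun _ s => ⋃ b ∈ s, {c | r b c}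
  have hS (n : ℕ) : (S n).Countable := by
    induction n with
    | zero => exact Set.countable_singleton a
    | succ n ih => exact ih.biUnion fun b _ => hr b
  refine (Set.countable_iUnion hS).mono fun b hb => ?_
  induction hb with
  | refl => exact Set.mem_iUnion.2 ⟨0, rfl⟩
  | tail _ hbc ih =>
    obtain ⟨n, hn⟩ := Set.mem_iUnion.1 ih
    exact Set.mem_iUnion.2 ⟨n + 1, Set.mem_biUnion hn hbc⟩

section Transition

variable {C : Type u} [SmallCategory C] {O : Type u} {X Y Z : C → Type u} {i : C}

theorem mem_image_transitionMap {f : ∀ k, X k → Y k} {S : Set (Transition O X i)} {j k : C}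
    {c : i ⟶ j} {o : O} {y : Y k} :
    (⟨j, c, o, ⟨k, y⟩⟩ : Transition O Y i) ∈ Transition.map f '' S ↔
      ∃ x, (⟨j, c, o, ⟨k, x⟩⟩ : Transition O X i) ∈ S ∧ f k x = y := by
  constructor
  · rintro ⟨⟨j', c', o', k', x⟩, hs, h⟩
    simp only [Transition.map, Transition.mk.injEq, Sigma.mk.injEq] at h
    obtain ⟨rfl, hc, rfl, rfl, hy⟩ := h
    obtain rfl := eq_of_heq hc
    exact ⟨x, hs, eq_of_heq hy⟩
  · rintro ⟨x, hx, rfl⟩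
    exact ⟨_, hx, rfl⟩

theorem transitionMap_jointly_injective {f : ∀ k, X k → Y k} {g : ∀ k, X k → Z k}
    (hfg : ∀ k x y, f k x = f k y → g k x = g k y → x = y) :
    Function.Injective fun t : Transition O X i => (t.map f, t.map g) := by
  rintro ⟨j, c, o, k, x⟩ ⟨j', c', o', k', x'⟩ h
  simp only [Transition.map, Prod.mk.injEq, Transition.mk.injEq, Sigma.mk.injEq] at h
  obtain ⟨⟨rfl, hc, rfl, rfl, hf⟩, -, -, -, -, hg⟩ := h
  obtain rfl := eq_of_heq hc
  obtain rfl := hfg k x x' (eq_of_heq hf) (eq_of_heq hg)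
  rfl

theorem transitionMap_injective {f : ∀ k, X k → Y k} (hf : ∀ k, Function.Injective (f k)) :
    Function.Injective (Transition.map (O := O) f (i := i)) := fun _ _ h =>
  transitionMap_jointly_injective (fun k _ _ hx _ => hf k hx) (Prod.ext h h)

end Transition

section Deriv

variable {C : Type u} [SmallCategory C] {O : Type u} {T : Set (Rule C O)}

theorem Deriv.map {X Y : C ⥤ Type u} (h : X ⟶ Y) {i k : C} {d : i ⟶ k}
    {t : Transition O X.obj i} {t' : Transition O X.obj k} :
    Deriv T X d t t' → Deriv T Y d (t.map fun k => h.app k) (t'.map fun k => h.app k)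
  | ⟨e, e', he, hT, hx⟩ =>
    ⟨e, e', he, hT, (NatTrans.naturality_apply h e' t.tgt.2).symm.trans (congrArg (h.app _) hx)⟩

theorem Deriv.exists_of_map {X Y : C ⥤ Type u} (h : X ⟶ Y) {i k : C} {d : i ⟶ k}
    {t : Transition O X.obj i} {t' : Transition O Y.obj k}
    (hd : Deriv T Y d (t.map fun k => h.app k) t') :
    ∃ s, Deriv T X d t s ∧ s.map (fun k => h.app k) = t' := by
  obtain ⟨j, c, o, l, y⟩ := t'
  obtain ⟨e, e', he, hT, hy⟩ := hd
  exact ⟨⟨j, c, o, l, X.map e' t.tgt.2⟩, ⟨e, e', he, hT, rfl⟩,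
    congrArg (fun y => Transition.mk j c o ⟨l, y⟩)
      ((NatTrans.naturality_apply h e' t.tgt.2).trans hy)⟩

end Deriv

section PDACoalgebra

variable {C : Type u} [SmallCategory C] [CountableCategory C] {O : Type u}

instance : (PDA C O).PreservesMonomorphisms where
  preserves {X Y} f _ := by
    have hf (k : C) : Function.Injective (f.app k) := (mono_iff_injective _).1 inferInstance
    refine (NatTrans.mono_iff_mono_app _).2 fun i => (mono_iff_injective _).2 fun S S' h => ?_
    exact Subtype.ext ((transitionMap_injective hf).image_injective (congrArg Subtype.val h))

instance : HasCoproducts.{u} (CoalgPDA C O) := fun _ =>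
  hasColimitsOfShape_of_hasColimitsOfShape_createsColimitsOfShape
    (Endofunctor.Coalgebra.forget (PDA C O))

theorem cofan_jointly_surjective {K : Type u} {A : K → CoalgPDA C O} {c : Cofan A}
    (hc : IsColimit c) {i : C} (x : c.pt.V.obj i) :
    ∃ (k : K) (a : (A k).V.obj i), (c.inj k).f.app i a = x := by
  let G := Endofunctor.Coalgebra.forget (PDA C O) ⋙ (evaluation C (Type u)).obj i
  obtain ⟨⟨k⟩, a, ha⟩ := Types.jointly_surjective _ (isColimitOfPreserves G hc) x
  exact ⟨k, a, ha⟩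

theorem outgoing_countable (A : CoalgPDA C O) {i : C} (p : A.V.obj i) :
    (outgoing A p).Countable :=
  (show PD O A.V.obj i from A.str.app i p).2

theorem mem_outgoing_map (A : CoalgPDA C O) {i k : C} (d : i ⟶ k) (p : A.V.obj i)
    (t : Transition O A.V.obj k) : t ∈ outgoing A (A.V.map d p) ↔ t.pre d ∈ outgoing A p := by
  have h := NatTrans.naturality_apply A.str d p
  exact Set.ext_iff.1 (congrArg Subtype.val h) t

theorem outgoing_app {A B : CoalgPDA C O} (f : A ⟶ B) {i : C} (p : A.V.obj i) :
    outgoing B (f.f.app i p) = Transition.map (fun k => f.f.app k) '' outgoing A p :=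
  (congrArg Subtype.val (congrArg (fun g => g.app i p) f.h)).symm

/-- The `PDA`-coalgebra on `X` whose sets of outgoing transitions are given by `α`. -/
def coalgMk (X : C ⥤ Type u) (α : ∀ i, X.obj i → Set (Transition O X.obj i))
    (hc : ∀ i p, (α i p).Countable)
    (hn : ∀ (i k : C) (d : i ⟶ k) (p : X.obj i) (t : Transition O X.obj k),
      t ∈ α k (X.map d p) ↔ t.pre d ∈ α i p) : CoalgPDA C O where
  V := X
  str :=
    { app i := ↾fun p => (⟨α i p, hc i p⟩ : PD O X.obj i)
      naturality i k d := by
        ext p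
        exact Subtype.ext (Set.ext (hn i k d p)) }

/-- The morphism of `PDA`-coalgebras given by a homomorphism of algebras that sends the outgoing
transitions of each state onto those of its image. -/
def coalgHomMk {A B : CoalgPDA C O} (f : A.V ⟶ B.V)
    (h : ∀ (i : C) (p : A.V.obj i),
      outgoing B (f.app i p) = Transition.map (fun k => f.app k) '' outgoing A p) : A ⟶ B where
  f := f
  h := by
    ext i p
    exact Subtype.ext (h i p).symm

section Restrict

variable (A : CoalgPDA C O) (S : Subfunctor A.V)

/-- The restriction of a `PDA`-coalgebra to a subalgebra `S`, keeping the transitions with target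
in `S`. It is a subcoalgebra only if all transitions from `S` have their target in `S`. -/
def restrictCoalg : CoalgPDA C O :=
  coalgMk S.toFunctor
    (fun i p => Transition.map (fun k => S.ι.app k) ⁻¹' outgoing A (S.ι.app i p))
    (fun _ _ => (outgoing_countable A _).preimage_of_injOn
      (transitionMap_injective fun _ => Subtype.val_injective).injOn)
    fun _ _ d p t => mem_outgoing_map A d (S.ι.app _ p) (t.map fun k => S.ι.app k)

variable {A S}

/-- The inclusion of the restriction to a subalgebra that contains the targets of its
transitions. -/
def restrictCoalgι
    (hS : ∀ ⦃i : C⦄, ∀ p ∈ S.obj i, ∀ t ∈ outgoing A p, t.tgt.2 ∈ S.obj t.tgt.1) :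
    restrictCoalg A S ⟶ A :=
  coalgHomMk S.ι fun i p => by
    refine (Set.image_preimage_eq_of_subset fun t ht => ?_).symm
    exact ⟨⟨t.cod, t.ctx, t.obs, ⟨t.tgt.1, t.tgt.2, hS p.1 p.2 t ht⟩⟩, rfl⟩

end Restrict

theorem exists_isHomomorphicImage {A B : CoalgPDA C O} (h : A ⟶ B) :
    ∃ J, IsHomomorphicImage h J := by
  have tgt_mem ⦃i : C⦄ (p) (hp : p ∈ (Subfunctor.range h.f).obj i) (t) (ht : t ∈ outgoing B p) :
      t.tgt.2 ∈ (Subfunctor.range h.f).obj t.tgt.1 := by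
    obtain ⟨a, rfl⟩ := hp
    rw [outgoing_app] at ht
    obtain ⟨s, -, rfl⟩ := ht
    exact ⟨s.tgt.2, rfl⟩
  let m := restrictCoalgι tgt_mem
  have : Mono m.f := inferInstanceAs (Mono (Subfunctor.range h.f).ι)
  let e : A ⟶ restrictCoalg B (Subfunctor.range h.f) :=
    { f := Subfunctor.toRange h.f, h := map_comp_str_of_mono m h rfl }
  exact ⟨_, e, m, (NatTrans.epi_iff_epi_app _).1 (inferInstanceAs (Epi (Subfunctor.toRange h.f))),
    (NatTrans.mono_iff_mono_app _).1 this, rfl⟩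

theorem exists_comp_eq_of_range_le {A B J : CoalgPDA C O} (m : J ⟶ B) [Mono m.f] (f : A ⟶ B)
    (h : Subfunctor.range f.f ≤ Subfunctor.range m.f) : ∃ g : A ⟶ J, g ≫ m = f := by
  obtain ⟨g, hg⟩ := (exists_comp_eq_iff_range_le m.f f.f).2 h
  exact ⟨{ f := g, h := map_comp_str_of_mono m f hg }, Endofunctor.Coalgebra.Hom.ext hg⟩

section SmallCarrier

/-- The category of sets of natural numbers: a small category into which every countable set
embeds. -/
abbrev NatSets : Type u := InducedCategory (Type u) fun s : Set (ULift.{u} ℕ) => (s : Type u)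

/-- The embedding of the sets of natural numbers into the category of types. -/
abbrev natSetsFunctor : NatSets.{u} ⥤ Type u := inducedFunctor _

variable (C O) in
/-- The `PDA`-coalgebras whose carriers are sets of natural numbers. These form a small type and
represent all `PDA`-coalgebras with countable carriers up to isomorphism. -/
def SmallCoalg : Type u :=
  Σ X : C ⥤ NatSets.{u}, (X ⋙ natSetsFunctor ⟶ (PDA C O).obj (X ⋙ natSetsFunctor))

/-- The underlying `PDA`-coalgebra of a coalgebra on sets of natural numbers. -/
def SmallCoalg.toCoalg (K : SmallCoalg C O) : CoalgPDA C O := ⟨K.1 ⋙ natSetsFunctor, K.2⟩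

theorem exists_natSetsFunctor_iso (X : Type u) [Countable X] :
    ∃ s : NatSets.{u}, Nonempty (natSetsFunctor.obj s ≅ X) := by
  obtain ⟨f, hf⟩ := exists_injective_nat X
  exact ⟨Set.range (ULift.up.{u} ∘ f),
    ⟨(Equiv.ofInjective _ (ULift.up_injective.comp hf)).symm.toIso⟩⟩

theorem exists_smallCoalg_iso (A : CoalgPDA C O) [∀ i, Countable (A.V.obj i)] :
    ∃ K : SmallCoalg C O, Nonempty (K.toCoalg ≅ A) := by
  choose s hs using fun i => exists_natSetsFunctor_iso (A.V.obj i)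
  let e (i : C) : natSetsFunctor.obj (s i) ≅ A.V.obj i := (hs i).some
  let X : C ⥤ NatSets.{u} :=
    { obj := s
      map {i j} d := InducedCategory.homMk ((e i).hom ≫ A.V.map d ≫ (e j).inv)
      map_id i := by
        ext1
        simp
      map_comp d d' := by
        ext1
        simp }
  let φ : X ⋙ natSetsFunctor ≅ A.V := NatIso.ofComponents e fun d => by simp [X]
  refine ⟨⟨X, φ.hom ≫ A.str ≫ (PDA C O).map φ.inv⟩, ⟨Endofunctor.Coalgebra.isoMk φ ?_⟩⟩
  change (φ.hom ≫ A.str ≫ (PDA C O).map φ.inv) ≫ (PDA C O).map φ.hom = φ.hom ≫ A.str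
  simp only [Category.assoc, ← Functor.map_comp, φ.inv_hom_id,
    CategoryTheory.Functor.map_id, Category.comp_id]

/-- One state is reached from another in one step, by an operator of the algebra or by a
transition. -/
def Step (A : CoalgPDA C O) (x y : Elements A.V.obj) : Prop :=
  (∃ d : x.1 ⟶ y.1, A.V.map d x.2 = y.2) ∨ ∃ t ∈ outgoing A x.2, t.tgt = y

theorem countable_setOf_step (A : CoalgPDA C O) (x : Elements A.V.obj) :
    {y | Step A x y}.Countable := by
  refine Set.Countable.union (Set.Countable.mono ?_ (Set.countable_iUnion fun j : C =>
    Set.countable_range fun d : x.1 ⟶ j => (⟨j, A.V.map d x.2⟩ : Elements A.V.obj)))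
    ((outgoing_countable A x.2).image Transition.tgt)
  rintro ⟨j, _⟩ ⟨d, hd⟩
  exact Set.mem_iUnion.2 ⟨j, d, congrArg (Sigma.mk j) hd⟩

/-- The least subalgebra containing a state and closed under transitions. -/
def reachable (A : CoalgPDA C O) (x : Elements A.V.obj) : Subfunctor A.V where
  obj i := {p | Relation.ReflTransGen (Step A) x ⟨i, p⟩}
  map d _ hp := hp.tail (Or.inl ⟨d, rfl⟩)

theorem exists_smallCoalg_hom (A : CoalgPDA C O) {i : C} (p : A.V.obj i) :
    ∃ (K : SmallCoalg C O) (f : K.toCoalg ⟶ A) (q : K.toCoalg.V.obj i), f.f.app i q = p := by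
  let S := reachable A ⟨i, p⟩
  have hS ⦃j : C⦄ (q) (hq : q ∈ S.obj j) (t) (ht : t ∈ outgoing A q) : t.tgt.2 ∈ S.obj t.tgt.1 :=
    Relation.ReflTransGen.tail hq (Or.inr ⟨t, ht, rfl⟩)
  have (j : C) : Countable ((restrictCoalg A S).V.obj j) :=
    ((countable_setOf_reflTransGen (countable_setOf_step A) _).preimage
      (sigma_mk_injective (i := j))).to_subtype
  obtain ⟨K, ⟨e⟩⟩ := exists_smallCoalg_iso (restrictCoalg A S)
  refine ⟨K, e.hom ≫ restrictCoalgι hS, e.inv.f.app i ⟨p, .refl⟩, ?_⟩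
  have he : e.inv ≫ e.hom ≫ restrictCoalgι hS = restrictCoalgι hS := e.inv_hom_id_assoc _
  exact congrArg (fun g => g.f.app i ⟨p, .refl⟩) he

theorem isSeparating_smallCoalg :
    (ObjectProperty.ofObj (SmallCoalg.toCoalg (C := C) (O := O))).IsSeparating := by
  intro A B f g h
  ext i p
  obtain ⟨K, k, q, rfl⟩ := exists_smallCoalg_hom A p
  exact congrArg (fun m => m.f.app i q) (h _ ⟨K⟩ k)

instance : HasTerminal (CoalgPDA C O) := hasTerminal_coalgebra isSeparating_smallCoalg

end SmallCarrier

section Covariety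

variable {P : ObjectProperty (CoalgPDA C O)}

/-- Inside a final coalgebra, the images of the coalgebras of a covariety form a small family,
and the image of the sum of representatives is the final coalgebra of the covariety. -/
theorem IsCovariety.hasTerminal (hP : IsCovariety P) : HasTerminal P.FullSubcategory := by
  let F : CoalgPDA C O := ⊤_ CoalgPDA C O
  let κ := {S : Subfunctor F.V // ∃ A, P A ∧ ∃ h : A ⟶ F, Subfunctor.range h.f = S}
  choose A hA h hrange using fun S : κ => S.2
  obtain ⟨J, e, m, he, hm, hem⟩ := exists_isHomomorphicImage (Sigma.desc h)
  have hJ : P J :=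
    hP.image _ _ _ J ⟨e, m, he, hm, hem⟩ (hP.sum _ A _ (colimit.isColimit _) hA)
  have : Mono m.f := (NatTrans.mono_iff_mono_app _).2 hm
  have hex (B : P.FullSubcategory) : ∃ g : B.obj ⟶ J, g ≫ m = terminal.from B.obj := by
    let S : κ := ⟨Subfunctor.range (terminal.from B.obj).f, _, B.property, _, rfl⟩
    refine exists_comp_eq_of_range_le m _ ?_
    calc Subfunctor.range (terminal.from B.obj).f
      _ = Subfunctor.range (h S).f := (hrange S).symm
      _ = Subfunctor.range ((Sigma.ι A S ≫ e).f ≫ m.f) := by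
        rw [← Sigma.ι_desc h S, ← hem]
        rfl
      _ ≤ Subfunctor.range m.f := Subfunctor.range_comp_le _ _
  choose g _ using hex
  have : Mono m := (Endofunctor.Coalgebra.forget (PDA C O)).mono_of_mono_map this
  exact (IsTerminal.ofUniqueHom (Y := (⟨J, hJ⟩ : P.FullSubcategory)) (fun B => P.homMk (g B))
    fun B f => P.hom_ext ((cancel_mono m).1 (terminal.hom_ext _ _))).hasTerminal

variable {F : CoalgPDA C O} (hF : IsTerminal F) {Z : P.FullSubcategory} (hZ : IsTerminal Z)

include hZ in
theorem monoComponents_from_of_isTerminal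
    (hP : ∀ (A B : CoalgPDA C O) (h : A ⟶ B) (J), IsHomomorphicImage h J → P A → P J) :
    MonoComponents (hF.from Z.obj).f := by
  obtain ⟨J, e, m, he, hm, hem⟩ := exists_isHomomorphicImage (hF.from Z.obj)
  let J' : P.FullSubcategory := ⟨J, hP _ _ _ J ⟨e, m, he, hm, hem⟩ Z.property⟩
  have retract : e ≫ (hZ.from J').hom = 𝟙 Z.obj :=
    congrArg (fun f => f.hom) (hZ.hom_ext (P.homMk e ≫ hZ.from J') (𝟙 Z))
  intro i
  have hm := hm i
  have : Mono (e.f.app i) :=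
    mono_of_mono_fac (h := 𝟙 (Z.obj.V.obj i)) (congrArg (fun g => g.f.app i) retract)
  rw [← hem]
  exact mono_comp (e.f.app i) (m.f.app i)

theorem from_eq_iff_of_isTerminal
    (hP : ∀ (A B : CoalgPDA C O) (h : A ⟶ B) (J), IsHomomorphicImage h J → P A → P J)
    (A : P.FullSubcategory) {i : C} (x y : A.obj.V.obj i) :
    (hZ.from A).hom.f.app i x = (hZ.from A).hom.f.app i y ↔
      (hF.from A.obj).f.app i x = (hF.from A.obj).f.app i y := by
  rw [← hF.hom_ext ((hZ.from A).hom ≫ hF.from Z.obj) (hF.from A.obj)]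
  exact ((mono_iff_injective _).1 (monoComponents_from_of_isTerminal hF hZ hP i)).eq_iff.symm

end Covariety

section Bisimulation

/-- Bisimulations between `PDA`-coalgebras: relations that are preserved by the operators and
under which transitions with equal labels match in both directions. -/
structure IsBisimulation (A B : CoalgPDA C O) (R : ∀ i : C, A.V.obj i → B.V.obj i → Prop) :
    Prop where
  map {i j : C} (d : i ⟶ j) {p q} : R i p q → R j (A.V.map d p) (B.V.map d q)
  forth {i : C} {p q} : R i p q → ∀ {j : C} {c : i ⟶ j} {o : O} {k : C} {p' : A.V.obj k},
    (⟨j, c, o, ⟨k, p'⟩⟩ : Transition O A.V.obj i) ∈ outgoing A p →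
      ∃ q', (⟨j, c, o, ⟨k, q'⟩⟩ : Transition O B.V.obj i) ∈ outgoing B q ∧ R k p' q'
  back {i : C} {p q} : R i p q → ∀ {j : C} {c : i ⟶ j} {o : O} {k : C} {q' : B.V.obj k},
    (⟨j, c, o, ⟨k, q'⟩⟩ : Transition O B.V.obj i) ∈ outgoing B q →
      ∃ p', (⟨j, c, o, ⟨k, p'⟩⟩ : Transition O A.V.obj i) ∈ outgoing A p ∧ R k p' q'

variable {A B D : CoalgPDA C O}

theorem isBisimulation_of_cospan (f : A ⟶ D) (g : B ⟶ D) :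
    IsBisimulation A B fun i p q => f.f.app i p = g.f.app i q where
  map d p q h := by
    rw [NatTrans.naturality_apply, NatTrans.naturality_apply, h]
  forth {i p q} h {j c o k p'} ht := by
    have hmem := (mem_image_transitionMap (f := fun k => f.f.app k)).2 ⟨p', ht, rfl⟩
    rw [← outgoing_app, h, outgoing_app, mem_image_transitionMap] at hmem
    obtain ⟨q', hq', heq⟩ := hmem
    exact ⟨q', hq', heq.symm⟩
  back {i p q} h {j c o k q'} ht := by
    have hmem := (mem_image_transitionMap (f := fun k => g.f.app k)).2 ⟨q', ht, rfl⟩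
    rwa [← outgoing_app, ← h, outgoing_app, mem_image_transitionMap] at hmem

namespace IsBisimulation

variable {R : ∀ i : C, A.V.obj i → B.V.obj i → Prop} (hR : IsBisimulation A B R)

/-- The graph of a bisimulation, as a subalgebra of the product. -/
def graph : Subfunctor (FunctorToTypes.prod A.V B.V) where
  obj i := {x | R i x.1 x.2}
  map d _ h := hR.map d h

/-- The first projection of the graph. -/
abbrev fst : hR.graph.toFunctor ⟶ A.V := hR.graph.ι ≫ FunctorToTypes.prod.fst

/-- The second projection of the graph. -/
abbrev snd : hR.graph.toFunctor ⟶ B.V := hR.graph.ι ≫ FunctorToTypes.prod.snd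

/-- The coalgebra on the graph of a bisimulation, with the matching pairs of transitions. -/
def graphCoalg : CoalgPDA C O :=
  coalgMk hR.graph.toFunctor
    (fun i x => {t | t.map (fun k => hR.fst.app k) ∈ outgoing A (hR.fst.app i x) ∧
      t.map (fun k => hR.snd.app k) ∈ outgoing B (hR.snd.app i x)})
    (fun i x => ((outgoing_countable A (hR.fst.app i x)).prod
      (outgoing_countable B (hR.snd.app i x))).preimage_of_injOn
        (transitionMap_jointly_injective fun _ _ _ h₁ h₂ => Subtype.ext (Prod.ext h₁ h₂)).injOn)
    fun _ _ d x t => and_congr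
      (mem_outgoing_map A d (hR.fst.app _ x) (t.map fun k => hR.fst.app k))
      (mem_outgoing_map B d (hR.snd.app _ x) (t.map fun k => hR.snd.app k))

/-- The first projection of the graph, as a morphism of coalgebras. -/
def graphFst : hR.graphCoalg ⟶ A :=
  coalgHomMk hR.fst fun i x => by
    refine Set.Subset.antisymm ?_ (Set.image_subset_iff.2 fun t ht => ht.1)
    rintro ⟨j, c, o, k, p'⟩ ht
    obtain ⟨q', hq', h⟩ := hR.forth x.2 ht
    exact mem_image_transitionMap.2 ⟨⟨(p', q'), h⟩, ⟨ht, hq'⟩, rfl⟩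

/-- The second projection of the graph, as a morphism of coalgebras. -/
def graphSnd : hR.graphCoalg ⟶ B :=
  coalgHomMk hR.snd fun i x => by
    refine Set.Subset.antisymm ?_ (Set.image_subset_iff.2 fun t ht => ht.2)
    rintro ⟨j, c, o, k, q'⟩ ht
    obtain ⟨p', hp', h⟩ := hR.back x.2 ht
    exact mem_image_transitionMap.2 ⟨⟨(p', q'), h⟩, ⟨hp', ht⟩, rfl⟩

include hR in
theorem from_eq_from {F : CoalgPDA C O} (hF : IsTerminal F) {i : C} {p : A.V.obj i}
    {q : B.V.obj i} (h : R i p q) : (hF.from A).f.app i p = (hF.from B).f.app i q :=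
  congrArg (fun f => f.f.app i ⟨(p, q), h⟩)
    (hF.hom_ext (hR.graphFst ≫ hF.from A) (hR.graphSnd ≫ hF.from B))

end IsBisimulation

variable (I : CIS C O) (hI : I.CountableDegree)

theorem CIS.isSatBisimulation_iff {R : ∀ i : C, I.alg.obj i → I.alg.obj i → Prop} :
    I.IsSatBisimulation R ↔
      (∀ i p q, R i p q → R i q p) ∧ IsBisimulation (I.satCoalg hI) (I.satCoalg hI) R := by
  constructor
  · rintro ⟨symm, map, transfer⟩
    refine ⟨symm, fun d _ _ h => map _ _ d _ _ h, fun h _ c _ _ _ ht => ?_,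
      fun h _ c _ _ _ ht => ?_⟩
    · exact transfer _ _ _ (map _ _ c _ _ h) _ _ _ ht
    · obtain ⟨p', hp', hr⟩ := transfer _ _ _ (map _ _ c _ _ (symm _ _ _ h)) _ _ _ ht
      exact ⟨p', hp', symm _ _ _ hr⟩
  · rintro ⟨symm, hR⟩
    refine ⟨symm, fun _ _ c _ _ h => hR.map c h, fun i p q h o k p' ht => ?_⟩
    have mem_outgoing_id (r : I.alg.obj i) (r' : I.alg.obj k) :
        (⟨i, 𝟙 i, o, ⟨k, r'⟩⟩ : Transition O I.alg.obj i) ∈ outgoing (I.satCoalg hI) r ↔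
          ((⟨i, r⟩ : Elements I.alg.obj), o, (⟨k, r'⟩ : Elements I.alg.obj)) ∈ I.tr := by
      change ((⟨i, I.alg.map (𝟙 i) r⟩ : Elements I.alg.obj), o, _) ∈ I.tr ↔ _
      rw [Functor.map_id_apply]
    obtain ⟨q', hq', hr⟩ := hR.forth h ((mem_outgoing_id p p').2 ht)
    exact ⟨q', (mem_outgoing_id q q').1 hq', hr⟩

theorem CIS.from_satCoalg_eq_iff_satBisim {F : CoalgPDA C O} (hF : IsTerminal F) {i : C}
    (p q : I.alg.obj i) :
    (hF.from (I.satCoalg hI)).f.app i p = (hF.from (I.satCoalg hI)).f.app i q ↔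
      I.SatBisim p q := by
  constructor
  · intro h
    have hbisim := isBisimulation_of_cospan (hF.from (I.satCoalg hI)) (hF.from (I.satCoalg hI))
    exact ⟨_, (I.isSatBisimulation_iff hI).2 ⟨fun _ _ _ hr => hr.symm, hbisim⟩, h⟩
  · rintro ⟨R, hR, h⟩
    exact ((I.isSatBisimulation_iff hI).1 hR).2.from_eq_from hF h

end Bisimulation

section InferenceSystem

variable {T : Set (Rule C O)}

theorem satisfies_of_jointly_surjective {B : CoalgPDA C O}
    (h : ∀ (i : C) (b : B.V.obj i), ∃ (A : CoalgPDA C O) (f : A ⟶ B) (a : A.V.obj i),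
      Satisfies T A ∧ f.f.app i a = b) : Satisfies T B := by
  intro i k d b t t' ht hd
  obtain ⟨A, f, a, hA, rfl⟩ := h i b
  rw [outgoing_app] at ht
  obtain ⟨s, hs, rfl⟩ := ht
  obtain ⟨s', hd', rfl⟩ := hd.exists_of_map f.f
  rw [← NatTrans.naturality_apply, outgoing_app]
  exact Set.mem_image_of_mem _ (hA d a s s' hs hd')

theorem satisfies_of_monoComponents {A B : CoalgPDA C O} (m : A ⟶ B) (hm : MonoComponents m.f)
    (hB : Satisfies T B) : Satisfies T A := by
  intro i k d p t t' ht hd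
  have hinj := transitionMap_injective (O := O) (i := k) fun j => (mono_iff_injective _).1 (hm j)
  have ht' := hB d (m.f.app i p) _ _ (outgoing_app m p ▸ Set.mem_image_of_mem _ ht) (hd.map m.f)
  rwa [← NatTrans.naturality_apply, outgoing_app, hinj.mem_set_image] at ht'

variable (T)

theorem isCovariety_satisfies : IsCovariety (Satisfies T) where
  sub _ _ := fun ⟨m, hm⟩ hB => satisfies_of_monoComponents m hm hB
  image A _ _ J := by
    rintro ⟨e, -, he, -, -⟩ hA
    refine satisfies_of_jointly_surjective fun i b => ?_
    obtain ⟨a, ha⟩ := (epi_iff_surjective _).1 (he i) b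
    exact ⟨A, e, a, hA, ha⟩
  sum K A c hc hA := satisfies_of_jointly_surjective fun i b => by
    obtain ⟨k, a, ha⟩ := cofan_jointly_surjective hc b
    exact ⟨A k, c.inj k, a, hA k, ha⟩

theorem satisfies_iff_isSaturated_outgoing (A : CoalgPDA C O) :
    Satisfies T A ↔ ∀ (i : C) (p : A.V.obj i), IsSaturated T A.V (outgoing A p) := by
  constructor
  · intro h i p t₁ ht₁ t₂ hd
    have := h (𝟙 i) p t₁ t₂ ht₁ hd
    rwa [Functor.map_id_apply] at this
  · intro h i k d p t t' ht hd
    rw [mem_outgoing_map]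
    exact h i p t ht _ (deriv_pre_iff.2 hd)

instance (X : C ⥤ Type u) : Mono ((incl T).app X) :=
  have (i : C) : Mono (((incl T).app X).app i) := (mono_iff_injective _).2 Subtype.val_injective
  NatTrans.mono_of_mono_app _

theorem factors_iff_isSaturated_outgoing (A : CoalgPDA C O) :
    Factors T A ↔ ∀ (i : C) (p : A.V.obj i), IsSaturated T A.V (outgoing A p) := by
  refine (exists_comp_eq_iff_range_le ((incl T).app A.V) A.str).trans
    ⟨fun h i p => ?_, fun h i => ?_⟩
  · obtain ⟨S, hS⟩ := h i ⟨p, rfl⟩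
    exact (congrArg (fun S : PD O A.V.obj i => IsSaturated T A.V S.1) hS).mp S.2
  · rintro _ ⟨p, rfl⟩
    exact ⟨⟨A.str.app i p, h i p⟩, rfl⟩

theorem factors_eq_satisfies : Factors T = Satisfies T := by
  ext A
  rw [factors_iff_isSaturated_outgoing, satisfies_iff_isSaturated_outgoing]

theorem isCovariety_factors : IsCovariety (Factors T) :=
  factors_eq_satisfies T ▸ isCovariety_satisfies T

instance : HasTerminal (CoalgPDAI T) := (isCovariety_factors T).hasTerminal

instance : (toCoalgPDAI T).Faithful :=
  Functor.Faithful.of_comp_iso ((Factors T).liftCompιIso (inclCoalg T) _)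

instance : (toCoalgPDAI T).Full :=
  Functor.Full.of_comp_faithful_iso ((Factors T).liftCompιIso (inclCoalg T) _)

theorem toCoalgPDAI_obj_bijective : Function.Bijective (toCoalgPDAI T).obj := by
  refine ⟨fun A B h => functorOfNatTrans_obj_injective (incl T) (congrArg (fun K => K.obj) h), ?_⟩
  rintro ⟨⟨X, α⟩, α', hα'⟩
  exact ⟨⟨X, α'⟩, ObjectProperty.FullSubcategory.ext (congrArg (Endofunctor.Coalgebra.mk X) hα')⟩

instance : (toCoalgPDAI T).IsEquivalence where
  essSurj := ⟨fun B =>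
    have ⟨A, hA⟩ := (toCoalgPDAI_obj_bijective T).surjective B
    ⟨A, ⟨eqToIso hA⟩⟩⟩

instance : HasTerminal (CoalgST T) := hasTerminal_of_equivalence (toCoalgPDAI T)

variable {T}

theorem from_eq_iff_inclCoalg_from_eq {F : CoalgPDA C O} (hF : IsTerminal F) {Z : CoalgST T}
    (hZ : IsTerminal Z) (A : CoalgST T) {i : C} (x y : A.V.obj i) :
    (hZ.from A).f.app i x = (hZ.from A).f.app i y ↔
      (hF.from ((inclCoalg T).obj A)).f.app i x = (hF.from ((inclCoalg T).obj A)).f.app i y := by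
  have hZ' : IsTerminal ((toCoalgPDAI T).obj Z) := hZ.isTerminalObj (toCoalgPDAI T)
  have h : (toCoalgPDAI T).map (hZ.from A) = hZ'.from ((toCoalgPDAI T).obj A) := hZ'.hom_ext _ _
  have kernel_iff :=
    from_eq_iff_of_isTerminal hF hZ' (isCovariety_factors T).image ((toCoalgPDAI T).obj A) x y
  rwa [← h] at kernel_iff

theorem CIS.from_eq_iff_satBisim (I : CIS C O) (hI : I.CountableDegree)
    {α' : I.alg ⟶ (ST T).obj I.alg} (hα' : α' ≫ (incl T).app I.alg = (I.satCoalg hI).str)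
    {Z : CoalgST T} (hZ : IsTerminal Z) {i : C} (p q : I.alg.obj i) :
    (hZ.from ⟨I.alg, α'⟩).f.app i p = (hZ.from ⟨I.alg, α'⟩).f.app i q ↔ I.SatBisim p q := by
  let hF : IsTerminal (⊤_ CoalgPDA C O) := terminalIsTerminal
  have satBisim_iff : (hF.from ⟨I.alg, (I.satCoalg hI).str⟩).f.app i p =
      (hF.from ⟨I.alg, (I.satCoalg hI).str⟩).f.app i q ↔ I.SatBisim p q :=
    I.from_satCoalg_eq_iff_satBisim hI hF p q
  rw [← hα'] at satBisim_iff
  exact (from_eq_iff_inclCoalg_from_eq hF hZ ⟨I.alg, α'⟩ p q).trans satBisim_iff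

end InferenceSystem

end PDACoalgebra

end SatCoalg

theorem mainTheorem3 {C : Type u} [SmallCategory C] [CountableCategory C] {O : Type u}
    (T : Set (SatCoalg.Rule C O)) :
    -- membership in `Coalg(PDA^I)` is satisfaction of `T`
    (∀ A : SatCoalg.CoalgPDA C O, SatCoalg.Factors T A ↔ SatCoalg.Satisfies T A) ∧
    -- homomorphic images and sums exist, and the coalgebras satisfying `T` form a covariety
    (∀ (A B : SatCoalg.CoalgPDA C O) (h : A ⟶ B), ∃ J, SatCoalg.IsHomomorphicImage h J) ∧
    HasCoproducts.{u} (SatCoalg.CoalgPDA C O) ∧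
    SatCoalg.IsCovariety (SatCoalg.Satisfies T) ∧
    -- `I` is an isomorphism of categories from `Coalg(S_T)` to `Coalg(PDA^I)`
    (∃ G : SatCoalg.CoalgPDAI T ⥤ SatCoalg.CoalgST T,
      SatCoalg.toCoalgPDAI T ⋙ G = 𝟭 _ ∧ G ⋙ SatCoalg.toCoalgPDAI T = 𝟭 _) ∧
    -- final objects exist
    HasTerminal (SatCoalg.CoalgPDA C O) ∧
    HasTerminal (SatCoalg.CoalgPDAI T) ∧
    HasTerminal (SatCoalg.CoalgST T) ∧
    -- the kernels of the final morphisms coincide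
    (∀ (F : SatCoalg.CoalgPDA C O) (hF : IsTerminal F)
      (Z : SatCoalg.CoalgPDAI T) (hZ : IsTerminal Z)
      (A : SatCoalg.CoalgPDAI T) (i : C) (x y : A.obj.V.obj i),
      (hZ.from A).hom.f.app i x = (hZ.from A).hom.f.app i y ↔
        (hF.from A.obj).f.app i x = (hF.from A.obj).f.app i y) ∧
    (∀ (F : SatCoalg.CoalgPDA C O) (hF : IsTerminal F)
      (Z : SatCoalg.CoalgST T) (hZ : IsTerminal Z)
      (A : SatCoalg.CoalgST T) (i : C) (x y : A.V.obj i),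
      (hZ.from A).f.app i x = (hZ.from A).f.app i y ↔
        (hF.from ((SatCoalg.inclCoalg T).obj A)).f.app i x =
          (hF.from ((SatCoalg.inclCoalg T).obj A)).f.app i y) ∧
    -- for a context interactive system these kernels are saturated bisimilarity
    (∀ (I : SatCoalg.CIS C O) (hI : I.CountableDegree),
      (∀ (F : SatCoalg.CoalgPDA C O) (hF : IsTerminal F) (i : C) (p q : I.alg.obj i),
        (hF.from (I.satCoalg hI)).f.app i p = (hF.from (I.satCoalg hI)).f.app i q ↔
          I.SatBisim p q) ∧
      (SatCoalg.Satisfies T (I.satCoalg hI) →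
        (∃! α' : I.alg ⟶ (SatCoalg.ST T).obj I.alg,
          α' ≫ (SatCoalg.incl T).app I.alg = (I.satCoalg hI).str) ∧
        ∀ α' : I.alg ⟶ (SatCoalg.ST T).obj I.alg,
          α' ≫ (SatCoalg.incl T).app I.alg = (I.satCoalg hI).str →
          ∀ (Z : SatCoalg.CoalgST T) (hZ : IsTerminal Z) (i : C) (p q : I.alg.obj i),
            (hZ.from ⟨I.alg, α'⟩).f.app i p = (hZ.from ⟨I.alg, α'⟩).f.app i q ↔
              I.SatBisim p q)) := by
  open SatCoalg in
  refine ⟨fun A => by rw [factors_eq_satisfies], fun A B h => exists_isHomomorphicImage h,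
    inferInstance, isCovariety_satisfies T,
    exists_strict_inverse _ (toCoalgPDAI_obj_bijective T), inferInstance, inferInstance,
    inferInstance, ?_, ?_, fun I hI => ⟨?_, fun hT => ⟨?_, ?_⟩⟩⟩
  · intro F hF Z hZ A i x y
    exact from_eq_iff_of_isTerminal hF hZ (isCovariety_factors T).image A x y
  · intro F hF Z hZ A i x y
    exact from_eq_iff_inclCoalg_from_eq hF hZ A x y
  · intro F hF i p q
    exact I.from_satCoalg_eq_iff_satBisim hI hF p q
  · obtain ⟨α', hα'⟩ : Factors T (I.satCoalg hI) := by rwa [factors_eq_satisfies]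
    exact ⟨α', hα', fun β hβ => (cancel_mono ((incl T).app I.alg)).1 (hβ.trans hα'.symm)⟩
  · intro α' hα' Z hZ i p q
    exact I.from_eq_iff_satBisim hI hα' hZ p q
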